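/- Let $\mathcal C$ be a semi-abelian category (pointed, Barr exact, protomodular, with finite coproducts), and let $H$ and $G$ be objects of $\mathcal C$. Suppose that $G$ has a split extension classifier (for instance, that $\mathcal C$ has split extension classifiers): there is a split extension $G \to P \rightleftarrows \operatorname{Aut} G$ which is terminal in the category of split extensions $G \xrightarrow{k} A \underset{s}{\overset{p}{\rightleftarrows}} B$ ($ps = 1_B$, $k=\ker p$) and morphisms inducing the identity on $G$. For objects $B, X$ let $j\colon B\flat X \to B+X$ be the kernel of $[1,0]\colon B+X\to B$; it gives a monad $B\flat(-)$, whose algebras $B\flat X\to X$ are the internal $B$-actions on $X$. Let $\chi_X=[1,1]\circ j\colon X\flat X\to X$ be the conjugation action. A crossed module is a morphism $\partial\colon N\to N_0$ with an internal action $\xi\colon N_0\flat N\to N$ such that $\xi\circ(\partial\flat 1)=\chi_N$ and $\partial\circ\xi=\chi_{N_0}\circ(1\flat\partial)$. A butterfly from $(\partial\colon M\to M_0,\xi)$ to $(\partial\colon N\to N_0,\xi)$ consists of an object $E$ and morphisms $\kappa\colon M\to E$, $\rho\colon E\to N_0$, $\iota\colon N\to E$, $\sigma\colon E\to M_0$ such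 that $\sigma\kappa=\partial$, $\rho\iota=\partial$, $\rho\kappa=0$, $\iota=\ker\sigma$, $\sigma=\operatorname{coker}\iota$, and $$\kappa\circ\xi\circ(\sigma\flat 1)=\chi_E\circ(1\flat\kappa),\qquad \iota\circ\xi\circ(\rho\flat 1)=\chi_E\circ(1\flat\iota).$$ Morphisms of butterflies are the morphisms $f\colon E\to E'$ commuting with all four structure morphisms. Butterflies between two fixed crossed modules and their morphisms form the hom-category $\mathcal B(\mathcal C)(-,-)$ of the bicategory of butterflies. A butterfly is split if its $\sigma$ has a section. Let $D(H)=(0\to H)$ be the discrete crossed module on $H$, and let $\mathcal A(G)$ be the crossed module $(\mathcal I_G\colon G\to\operatorname{Aut}G,\ \mathrm{ev}\colon\operatorname{Aut}G\flat G\to G)$, where $\mathrm{ev}$ is the action associated with the universal split extension and $\mathcal I_G$ classifies the split extension $G\xrightarrow{\langle 1,0\rangle}G\times G\rightleftarrows G$ given by the second projection and the diagonal. Let $\mathrm{Ext}(H,G)$ be the category of extensions $H\xleftarrow{\sigma}E\xleftarrow{\iota}G$ ($\iota=\ker\sigma$, $\sigma=\operatorname{coker}\iota$), with morphisms $f\colon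 E\to E'$ satisfying $f\iota=\iota'$ and $\sigma' f=\sigma$. Then $\mathrm{Ext}(H,G)$ and $\mathcal B(\mathcal C)(D(H),\mathcal A(G))$ are groupoids, and the functor $$\mathcal B(\mathcal C)(D(H),\mathcal A(G))\to\mathrm{Ext}(H,G),\qquad (E,\kappa,\rho,\iota,\sigma)\mapsto(E,\iota,\sigma),\quad f\mapsto f,$$ is an isomorphism of categories (bijective on objects, full and faithful). It restricts to an isomorphism between the full subcategories of split butterflies and of split extensions (those whose $\sigma$ has a section). -/

import Mathlib

open CategoryTheory CategoryTheory.Limits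
open scoped ZeroObject

universe v u

namespace SemiAb

/-- `k` is a kernel of `p`. -/
def IsKernelOf {C : Type u} [Category.{v} C] [HasZeroMorphisms C] {K A B : C}
    (k : K ⟶ A) (p : A ⟶ B) : Prop :=
  ∃ w : k ≫ p = 0, Nonempty (IsLimit (KernelFork.ofι k w))

/-- `q` is a cokernel of `f`. -/
def IsCokernelOf {C : Type u} [Category.{v} C] [HasZeroMorphisms C] {A B Q : C}
    (q : B ⟶ Q) (f : A ⟶ B) : Prop :=
  ∃ w : f ≫ q = 0, Nonempty (IsColimit (CokernelCofork.ofπ q w))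

/-- A semi-abelian category: a pointed category with finite coproducts which is Barr exact (it is
regular and every internal equivalence relation is a kernel pair) and protomodular (for pointed
finitely complete categories: the split short five lemma holds). -/
class SemiAbelian (C : Type u) [Category.{v} C] [HasZeroObject C] [HasZeroMorphisms C] : Prop
    extends Regular C where
  hasFiniteCoproducts : HasFiniteCoproducts C
  exists_isKernelPair {R X : C} (p₁ p₂ : R ⟶ X) [IsEquivalenceRelation p₁ p₂] :
    ∃ (Y : C) (f : X ⟶ Y), IsKernelPair f p₁ p₂
  split_short_five {K A B K' A' B' : C} (k : K ⟶ A) (p : A ⟶ B) (s : B ⟶ A)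
    (k' : K' ⟶ A') (p' : A' ⟶ B') (s' : B' ⟶ A')
    (_ : IsKernelOf k p) (_ : s ≫ p = 𝟙 B) (_ : IsKernelOf k' p') (_ : s' ≫ p' = 𝟙 B')
    (h : K ⟶ K') (f : A ⟶ A') (g : B ⟶ B')
    (_ : k ≫ f = h ≫ k') (_ : p ≫ g = f ≫ p') (_ : s ≫ f = g ≫ s')
    (_ : IsIso h) (_ : IsIso g) : IsIso f

attribute [instance] SemiAbelian.hasFiniteCoproducts

section

variable {C : Type u} [Category.{v} C] [HasZeroMorphisms C]

namespace IsKernelOf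

variable {K A B : C} {k : K ⟶ A} {p : A ⟶ B}

theorem comp_zero (h : IsKernelOf k p) : k ≫ p = 0 := h.choose

theorem hom_ext (h : IsKernelOf k p) {T : C} {a b : T ⟶ K} (e : a ≫ k = b ≫ k) : a = b :=
  Fork.IsLimit.hom_ext h.choose_spec.some e

theorem exists_lift (h : IsKernelOf k p) {T : C} (a : T ⟶ A) (e : a ≫ p = 0) :
    ∃ l : T ⟶ K, l ≫ k = a :=
  ⟨h.choose_spec.some.lift (KernelFork.ofι a e),
    h.choose_spec.some.fac (KernelFork.ofι a e) WalkingParallelPair.zero⟩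

theorem mk' (w : k ≫ p = 0) (hk : ∀ {T : C} (a b : T ⟶ K), a ≫ k = b ≫ k → a = b)
    (hl : ∀ {T : C} (a : T ⟶ A), a ≫ p = 0 → ∃ l : T ⟶ K, l ≫ k = a) : IsKernelOf k p :=
  ⟨w, ⟨KernelFork.IsLimit.ofι k w (fun a e => (hl a e).choose)
    (fun a e => (hl a e).choose_spec)
    (fun a e _ hm => hk _ _ (hm.trans (hl a e).choose_spec.symm))⟩⟩

end IsKernelOf

variable [HasZeroObject C] [SemiAbelian C]

attribute [local simp] coprod.inl_desc coprod.inr_desc coprod.inl_desc_assoc coprod.inr_desc_assoc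
  prod.lift_fst prod.lift_snd prod.lift_fst_assoc prod.lift_snd_assoc pullback.lift_fst
  pullback.lift_snd pullback.lift_fst_assoc pullback.lift_snd_assoc

/-! ### Internal actions -/

/-- The object `B ♭ X`, the kernel of `[1, 0] : B + X ⟶ B`. -/
noncomputable def flat (B X : C) : C := kernel (coprod.desc (𝟙 B) (0 : X ⟶ B))

/-- The kernel inclusion `j : B ♭ X ⟶ B + X`. -/
noncomputable def flatι (B X : C) : flat B X ⟶ B ⨿ X := kernel.ι _

theorem flatι_desc (B X : C) : flatι B X ≫ coprod.desc (𝟙 B) (0 : X ⟶ B) = 0 :=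
  kernel.condition _

/-- The morphism into `B ♭ X` induced by its universal property. -/
noncomputable def flatLift {B X T : C} (a : T ⟶ B ⨿ X)
    (h : a ≫ coprod.desc (𝟙 B) (0 : X ⟶ B) = 0) : T ⟶ flat B X := kernel.lift _ a h

theorem flatLift_ι {B X T : C} (a : T ⟶ B ⨿ X)
    (h : a ≫ coprod.desc (𝟙 B) (0 : X ⟶ B) = 0) : flatLift a h ≫ flatι B X = a :=
  kernel.lift_ι _ _ _

theorem flatι_desc_zero {B X T : C} (f : B ⟶ T) :
    flatι B X ≫ coprod.desc f (0 : X ⟶ T) = 0 := by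
  have h : coprod.desc f (0 : X ⟶ T) = coprod.desc (𝟙 B) (0 : X ⟶ B) ≫ f := by
    ext <;> simp
  rw [h, ← Category.assoc, flatι_desc, zero_comp]

/-- The morphism `f ♭ g : B ♭ X ⟶ B' ♭ X'`, restriction of `f + g`. -/
noncomputable def flatMap {B B' X X' : C} (f : B ⟶ B') (g : X ⟶ X') : flat B X ⟶ flat B' X' :=
  flatLift (flatι B X ≫ coprod.map f g) (by
    have h : coprod.map f g ≫ coprod.desc (𝟙 B') (0 : X' ⟶ B') = coprod.desc f 0 := by
      ext <;> simp
    rw [Category.assoc, h, flatι_desc_zero])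

theorem flatMap_ι {B B' X X' : C} (f : B ⟶ B') (g : X ⟶ X') :
    flatMap f g ≫ flatι B' X' = flatι B X ≫ coprod.map f g := flatLift_ι _ _

/-- The unit `X ⟶ B ♭ X` of the monad `B ♭ (-)`. -/
noncomputable def flatUnit (B X : C) : X ⟶ flat B X := flatLift coprod.inr (by simp)

theorem flatUnit_ι (B X : C) : flatUnit B X ≫ flatι B X = coprod.inr := flatLift_ι _ _

/-- The multiplication `B ♭ (B ♭ X) ⟶ B ♭ X` of the monad `B ♭ (-)`, restriction of
`[inl, j] : B + (B ♭ X) ⟶ B + X`. -/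
noncomputable def flatMul (B X : C) : flat B (flat B X) ⟶ flat B X :=
  flatLift (flatι B (flat B X) ≫ coprod.desc coprod.inl (flatι B X)) (by
    have h : coprod.desc coprod.inl (flatι B X) ≫ coprod.desc (𝟙 B) (0 : X ⟶ B) =
        coprod.desc (𝟙 B) 0 := by
      ext <;> simp [flatι_desc]
    rw [Category.assoc, h, flatι_desc])

theorem flatMul_ι (B X : C) : flatMul B X ≫ flatι B X =
    flatι B (flat B X) ≫ coprod.desc coprod.inl (flatι B X) := flatLift_ι _ _

/-- The conjugation action `χ_X : X ♭ X ⟶ X`. -/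
noncomputable def conj (X : C) : flat X X ⟶ X := flatι X X ≫ coprod.desc (𝟙 X) (𝟙 X)

/-- `ξ : B ♭ X ⟶ X` is an internal action: an algebra for the monad `B ♭ (-)`. -/
structure IsAction {B X : C} (ξ : flat B X ⟶ X) : Prop where
  unit : flatUnit B X ≫ ξ = 𝟙 X
  mul : flatMul B X ≫ ξ = flatMap (𝟙 B) ξ ≫ ξ

variable (C) in
/-- Internal crossed modules `∂ : top ⟶ base`. -/
structure CrossedModule where
  top : C
  base : C
  bd : top ⟶ base
  act : flat base top ⟶ top
  isAction : IsAction act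
  peiffer : flatMap bd (𝟙 top) ≫ act = conj top
  precrossed : act ≫ bd = flatMap (𝟙 base) bd ≫ conj base

/-! ### Extensions -/

/-- An extension `H ⟵ E ⟵ G`. -/
structure Extension (H G : C) where
  E : C
  ι : G ⟶ E
  σ : E ⟶ H
  isKernel : IsKernelOf ι σ
  isCokernel : IsCokernelOf σ ι

namespace Extension

/-- A morphism of extensions of `H` by `G`, over the identities of `G` and `H`. -/
@[ext]
structure Hom {H G : C} (X Y : Extension H G) where
  f : X.E ⟶ Y.E
  ι_f : X.ι ≫ f = Y.ι
  f_σ : f ≫ Y.σ = X.σ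

/-- `Ext(H, G)`. -/
instance category (H G : C) : Category (Extension H G) where
  Hom := Hom
  id X := ⟨𝟙 _, Category.comp_id _, Category.id_comp _⟩
  comp a b := ⟨a.f ≫ b.f, by rw [← Category.assoc, a.ι_f, b.ι_f],
    by rw [Category.assoc, b.f_σ, a.f_σ]⟩
  id_comp a := Hom.ext (Category.id_comp a.f)
  comp_id a := Hom.ext (Category.comp_id a.f)
  assoc a b c := Hom.ext (Category.assoc a.f b.f c.f)

/-- Split extensions. -/
def isSplit (H G : C) : ObjectProperty (Extension H G) :=
  fun X => ∃ s : H ⟶ X.E, s ≫ X.σ = 𝟙 H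

end Extension

/-! ### Butterflies -/

/-- A butterfly from the crossed module `M` to the crossed module `N`. -/
structure Butterfly (M N : CrossedModule C) where
  E : C
  κ : M.top ⟶ E
  ρ : E ⟶ N.base
  ι : N.top ⟶ E
  σ : E ⟶ M.base
  left_wing : κ ≫ σ = M.bd
  right_wing : ι ≫ ρ = N.bd
  complex : κ ≫ ρ = 0
  isKernel : IsKernelOf ι σ
  isCokernel : IsCokernelOf σ ι
  left_act : flatMap σ (𝟙 M.top) ≫ M.act ≫ κ = flatMap (𝟙 E) κ ≫ conj E
  right_act : flatMap ρ (𝟙 N.top) ≫ N.act ≫ ι = flatMap (𝟙 E) ι ≫ conj E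

namespace Butterfly

/-- A morphism of butterflies. -/
@[ext]
structure Hom {M N : CrossedModule C} (X Y : Butterfly M N) where
  f : X.E ⟶ Y.E
  κ_f : X.κ ≫ f = Y.κ
  f_ρ : f ≫ Y.ρ = X.ρ
  ι_f : X.ι ≫ f = Y.ι
  f_σ : f ≫ Y.σ = X.σ

/-- The hom-category from `M` to `N` in the bicategory of crossed modules and butterflies. -/
instance category (M N : CrossedModule C) : Category (Butterfly M N) where
  Hom := Hom
  id X := ⟨𝟙 _, Category.comp_id _, Category.id_comp _, Category.comp_id _, Category.id_comp _⟩
  comp a b := ⟨a.f ≫ b.f, by rw [← Category.assoc, a.κ_f, b.κ_f],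
    by rw [Category.assoc, b.f_ρ, a.f_ρ], by rw [← Category.assoc, a.ι_f, b.ι_f],
    by rw [Category.assoc, b.f_σ, a.f_σ]⟩
  id_comp a := Hom.ext (Category.id_comp a.f)
  comp_id a := Hom.ext (Category.comp_id a.f)
  assoc a b c := Hom.ext (Category.assoc a.f b.f c.f)

/-- Split butterflies. -/
def isSplit (M N : CrossedModule C) : ObjectProperty (Butterfly M N) :=
  fun X => ∃ s : M.base ⟶ X.E, s ≫ X.σ = 𝟙 M.base

end Butterfly

/-! ### The discrete crossed module -/

/-- The discrete crossed module `D(H) = (0 ⟶ H)`. -/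
noncomputable def discrete (H : C) : CrossedModule C where
  top := 0
  base := H
  bd := 0
  act := 0
  isAction := ⟨(isZero_zero C).eq_of_tgt _ _, (isZero_zero C).eq_of_tgt _ _⟩
  peiffer := (isZero_zero C).eq_of_tgt _ _
  precrossed := by
    have h : coprod.map (𝟙 H) (0 : (0 : C) ⟶ H) ≫ coprod.desc (𝟙 H) (𝟙 H) =
        coprod.desc (𝟙 H) 0 := by
      apply coprod.hom_ext <;> simp
    rw [conj, ← Category.assoc, flatMap_ι, Category.assoc, h, flatι_desc, zero_comp]

/-! ### Split extension classifiers -/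

/-- A split extension with kernel object `G`. -/
structure SplitExtension (G : C) where
  B : C
  A : C
  k : G ⟶ A
  p : A ⟶ B
  s : B ⟶ A
  isKernel : IsKernelOf k p
  s_p : s ≫ p = 𝟙 B

namespace SplitExtension

variable {G : C}

/-- A morphism of split extensions with kernel object `G` inducing the identity on `G`. -/
@[ext]
structure Hom (X Y : SplitExtension G) where
  base : X.B ⟶ Y.B
  total : X.A ⟶ Y.A
  k_total : X.k ≫ total = Y.k
  p_base : X.p ≫ base = total ≫ Y.p
  s_total : X.s ≫ total = base ≫ Y.s

instance category (G : C) : Category (SplitExtension G) where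
  Hom := Hom
  id X := ⟨𝟙 _, 𝟙 _, Category.comp_id _, by simp, by simp⟩
  comp a b := ⟨a.base ≫ b.base, a.total ≫ b.total, by rw [← Category.assoc, a.k_total, b.k_total],
    by rw [← Category.assoc, a.p_base, Category.assoc, b.p_base, Category.assoc],
    by rw [← Category.assoc, a.s_total, Category.assoc, b.s_total, Category.assoc]⟩
  id_comp a := Hom.ext (Category.id_comp a.base) (Category.id_comp a.total)
  comp_id a := Hom.ext (Category.comp_id a.base) (Category.comp_id a.total)
  assoc a b c := Hom.ext (Category.assoc a.base b.base c.base)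
    (Category.assoc a.total b.total c.total)

theorem flatι_desc_p (X : SplitExtension G) :
    (flatι X.B G ≫ coprod.desc X.s X.k) ≫ X.p = 0 := by
  have h : coprod.desc X.s X.k ≫ X.p = coprod.desc (𝟙 X.B) 0 := by
    ext <;> simp [X.s_p, X.isKernel.comp_zero]
  rw [Category.assoc, h, flatι_desc]

/-- The action of `B` on `G` associated with a split extension: the restriction of
`[s, k] : B + G ⟶ A` to the kernels. -/
noncomputable def action (X : SplitExtension G) : flat X.B G ⟶ G :=
  (X.isKernel.exists_lift _ X.flatι_desc_p).choose

theorem action_k (X : SplitExtension G) :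
    X.action ≫ X.k = flatι X.B G ≫ coprod.desc X.s X.k :=
  (X.isKernel.exists_lift _ X.flatι_desc_p).choose_spec

theorem isAction (X : SplitExtension G) : IsAction X.action where
  unit := X.isKernel.hom_ext (by
    rw [Category.assoc, action_k, ← Category.assoc, flatUnit_ι, coprod.inr_desc, Category.id_comp])
  mul := X.isKernel.hom_ext (by
    have h : coprod.desc coprod.inl (flatι X.B G) ≫ coprod.desc X.s X.k =
        coprod.map (𝟙 X.B) X.action ≫ coprod.desc X.s X.k := by
      ext <;> simp [action_k]
    rw [Category.assoc, action_k, ← Category.assoc, flatMul_ι, Category.assoc, h,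
      Category.assoc, action_k, ← Category.assoc (flatMap _ _), flatMap_ι, Category.assoc])

/-- Actions are compatible with morphisms of split extensions. -/
theorem flatMap_action {X Y : SplitExtension G} (a : X ⟶ Y) :
    flatMap a.base (𝟙 G) ≫ Y.action = X.action := Y.isKernel.hom_ext (by
  have h : coprod.map a.base (𝟙 G) ≫ coprod.desc Y.s Y.k = coprod.desc X.s X.k ≫ a.total := by
    ext <;> simp [a.s_total, a.k_total]
  rw [Category.assoc, action_k, ← Category.assoc, flatMap_ι, Category.assoc, h,
    ← a.k_total, ← Category.assoc, ← Category.assoc, action_k])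

/-- The split extension `G ⟶ G × G ⇄ G` given by `⟨1, 0⟩`, the second projection and the
diagonal. -/
noncomputable def diagonal (G : C) : SplitExtension G where
  B := G
  A := G ⨯ G
  k := prod.lift (𝟙 G) 0
  p := prod.snd
  s := prod.lift (𝟙 G) (𝟙 G)
  isKernel := IsKernelOf.mk' (by simp)
    (fun a b h => by simpa using congrArg (· ≫ (prod.fst : G ⨯ G ⟶ G)) h)
    (fun a h => ⟨a ≫ prod.fst, by ext <;> simp [h]⟩)
  s_p := by simp

theorem diagonal_action (G : C) : (diagonal G).action = conj G := by
  have h : (diagonal G).action ≫ prod.lift (𝟙 G) (0 : G ⟶ G) =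
    flatι G G ≫ coprod.desc (prod.lift (𝟙 G) (𝟙 G)) (prod.lift (𝟙 G) 0) := (diagonal G).action_k
  have e : coprod.desc (prod.lift (𝟙 G) (𝟙 G)) (prod.lift (𝟙 G) 0) ≫ (prod.fst : G ⨯ G ⟶ G) =
      coprod.desc (𝟙 G) (𝟙 G) := by
    ext <;> simp
  have h' : (diagonal G).action ≫ prod.lift (𝟙 G) (0 : G ⟶ G) ≫ prod.fst =
      flatι G G ≫ coprod.desc (prod.lift (𝟙 G) (𝟙 G)) (prod.lift (𝟙 G) 0) ≫ prod.fst :=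
    (Category.assoc _ _ _).symm.trans
      ((congrArg (· ≫ (prod.fst : G ⨯ G ⟶ G)) h).trans (Category.assoc _ _ _))
  rw [e, prod.lift_fst] at h'
  exact (Category.comp_id _).symm.trans h'

/-- The split extension `G ⟶ A ×_B A ⇄ A` given by `⟨k, 0⟩`, the second projection and the
diagonal of the kernel pair of `p`. -/
noncomputable def kernelPair (X : SplitExtension G) : SplitExtension G where
  B := X.A
  A := pullback X.p X.p
  k := pullback.lift X.k 0 (by simp [X.isKernel.comp_zero])
  p := pullback.snd X.p X.p
  s := pullback.lift (𝟙 _) (𝟙 _) rfl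
  isKernel := IsKernelOf.mk' (by simp)
    (fun a b h => X.isKernel.hom_ext (by
      simpa using congrArg (· ≫ pullback.fst X.p X.p) h))
    (fun a h => by
      obtain ⟨l, hl⟩ := X.isKernel.exists_lift (a ≫ pullback.fst X.p X.p) (by
        rw [Category.assoc, pullback.condition, ← Category.assoc, h, zero_comp])
      exact ⟨l, by ext <;> simp [hl, h]⟩)
  s_p := by simp

/-- The morphism from the diagonal split extension to that of the kernel pair, induced by `k`. -/
noncomputable def diagonalToKernelPair (X : SplitExtension G) : diagonal G ⟶ X.kernelPair where
  base := X.k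
  total := (pullback.lift (prod.fst ≫ X.k) (prod.snd ≫ X.k) (by simp [X.isKernel.comp_zero]) :
    G ⨯ G ⟶ pullback X.p X.p)
  k_total := by
    change prod.lift (𝟙 G) 0 ≫ _ = pullback.lift X.k 0 _
    apply pullback.hom_ext <;> simp
  p_base := by
    change prod.snd ≫ X.k = _ ≫ pullback.snd X.p X.p
    simp
  s_total := by
    change prod.lift (𝟙 G) (𝟙 G) ≫ _ = X.k ≫ pullback.lift (𝟙 _) (𝟙 _) _
    apply pullback.hom_ext <;> simp

/-- The morphism from a split extension to that of its kernel pair, induced by `s`. -/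
noncomputable def toKernelPair (X : SplitExtension G) : X ⟶ X.kernelPair where
  base := X.s
  total := (pullback.lift (𝟙 _) (X.p ≫ X.s) (by simp [X.s_p]) : X.A ⟶ pullback X.p X.p)
  k_total := by
    change X.k ≫ _ = pullback.lift X.k 0 _
    have h : X.k ≫ X.p ≫ X.s = 0 := by
      rw [← Category.assoc, X.isKernel.comp_zero, zero_comp]
    apply pullback.hom_ext <;> simp [h]
  p_base := by
    change X.p ≫ X.s = _ ≫ pullback.snd X.p X.p
    simp
  s_total := by
    change X.s ≫ _ = X.s ≫ pullback.lift (𝟙 _) (𝟙 _) _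
    have h : X.s ≫ X.p ≫ X.s = X.s := by
      rw [← Category.assoc, X.s_p, Category.id_comp]
    apply pullback.hom_ext <;> simp [h]

end SplitExtension

/-- A split extension classifier of `G`: a terminal object in the category of split extensions with
kernel object `G` (and morphisms inducing the identity on `G`), so that every split extension
`G ⟶ A ⇄ B` is pulled back from it along a unique morphism `B ⟶ Aut G`. -/
structure SplitExtensionClassifier (G : C) where
  univ : SplitExtension G
  isTerminal : IsTerminal univ

namespace SplitExtensionClassifier

variable {G : C} (A : SplitExtensionClassifier G)

/-- The object `Aut G`. -/
def aut : C := A.univ.B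

/-- The morphism `B ⟶ Aut G` classifying a split extension. -/
def classify (X : SplitExtension G) : X.B ⟶ A.aut := (A.isTerminal.from X).base

theorem base_eq {X : SplitExtension G} (a : X ⟶ A.univ) : a.base = A.classify X := by
  rw [A.isTerminal.hom_ext a (A.isTerminal.from X)]
  rfl

/-- The morphism `I_G : G ⟶ Aut G`, classifying `G ⟶ G × G ⇄ G`. -/
noncomputable def inner : G ⟶ A.aut := A.classify (SplitExtension.diagonal G)

/-- The evaluation action `ev : Aut G ♭ G ⟶ G`, associated with the universal split extension. -/
noncomputable def ev : flat A.aut G ⟶ G := A.univ.action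

/-- The domain morphism `G ⋊ Aut G ⟶ Aut G` of the action groupoid (the codomain morphism being
the split epimorphism of the universal split extension). -/
noncomputable def dom : A.univ.A ⟶ A.aut := A.classify A.univ.kernelPair

theorem k_dom : A.univ.k ≫ A.dom = A.inner :=
  A.base_eq (A.univ.diagonalToKernelPair ≫ A.isTerminal.from A.univ.kernelPair)

theorem s_dom : A.univ.s ≫ A.dom = 𝟙 A.aut :=
  (A.base_eq (A.univ.toKernelPair ≫ A.isTerminal.from A.univ.kernelPair)).trans
    (A.base_eq (𝟙 A.univ)).symm

theorem flatMap_inner_ev : flatMap A.inner (𝟙 G) ≫ A.ev = conj G :=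
  (SplitExtension.flatMap_action (A.isTerminal.from (SplitExtension.diagonal G))).trans
    (SplitExtension.diagonal_action G)

theorem ev_inner : A.ev ≫ A.inner = flatMap (𝟙 A.aut) A.inner ≫ conj A.aut := by
  have e : A.ev ≫ A.univ.k = flatι A.aut G ≫ coprod.desc A.univ.s A.univ.k := A.univ.action_k
  have h : coprod.desc A.univ.s A.univ.k ≫ A.dom = coprod.desc (𝟙 A.aut) A.inner := by
    rw [coprod.desc_comp, k_dom, s_dom]
    rfl
  have h' : coprod.map (𝟙 A.aut) A.inner ≫ coprod.desc (𝟙 A.aut) (𝟙 A.aut) =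
      coprod.desc (𝟙 A.aut) A.inner := by
    ext <;> simp
  calc A.ev ≫ A.inner = (A.ev ≫ A.univ.k) ≫ A.dom := by rw [Category.assoc, A.k_dom]
    _ = flatι A.aut G ≫ (coprod.desc A.univ.s A.univ.k ≫ A.dom) := by
      rw [e]; exact Category.assoc _ _ _
    _ = flatι A.aut G ≫ coprod.desc (𝟙 A.aut) A.inner := congrArg (flatι A.aut G ≫ ·) h
    _ = flatMap (𝟙 A.aut) A.inner ≫ conj A.aut := by
      rw [conj, ← Category.assoc, flatMap_ι, Category.assoc, h']

/-- The crossed module `A(G) = (I_G : G ⟶ Aut G, ev)`. -/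
noncomputable def crossedModule : CrossedModule C where
  top := G
  base := A.aut
  bd := A.inner
  act := A.ev
  isAction := A.univ.isAction
  peiffer := A.flatMap_inner_ev
  precrossed := A.ev_inner

end SplitExtensionClassifier

/-! ### From butterflies to extensions -/

/-- The functor `B(C)(D(H), A(G)) ⥤ Ext(H, G)` sending a butterfly `(E, κ, ρ, ι, σ)` to the
extension `(E, ι, σ)` and a morphism `f` to `f`. -/
noncomputable def butterflyToExtension (H : C) {G : C} (A : SplitExtensionClassifier G) :
    Butterfly (discrete H) A.crossedModule ⥤ Extension H G where
  obj X := ⟨X.E, X.ι, X.σ, X.isKernel, X.isCokernel⟩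
  map a := ⟨a.f, a.ι_f, a.f_σ⟩

/-- The restriction of `butterflyToExtension` to split butterflies and split extensions. -/
noncomputable def splitButterflyToSplitExtension (H : C) {G : C} (A : SplitExtensionClassifier G) :
    (Butterfly.isSplit (discrete H) A.crossedModule).FullSubcategory ⥤
      (Extension.isSplit H G).FullSubcategory :=
  (Extension.isSplit H G).lift
    ((Butterfly.isSplit (discrete H) A.crossedModule).ι ⋙ butterflyToExtension H A)
    (fun X => X.property)

end

end SemiAb

/-!
Conjugation makes an extension `G ⟶ E ⟶ H` into a split extension with kernel `G`: the kernel pair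
`E ×_H E ⇄ E` of `σ`, split by the diagonal. The associated action of `E` on `G` is conjugation,
restricted to `G`. Pulling back along `σ`, one sees that a morphism of extensions becomes a morphism
of split extensions, hence invertible by the split short five lemma; since `σ` is a regular
epimorphism, the morphism is invertible already (`Extension.isIso_f`).

The left half of a butterfly out of `D(H)` is trivial, so a butterfly `D(H) ⟶ A(G)` is an extension
together with `ρ : E ⟶ Aut G` such that `ι ≫ ρ = I_G` and such that the action of `E` on `G` obtained
from `ev` along `ρ` is conjugation. The morphism classifying the kernel pair is such a `ρ`
(`Extension.toButterfly`). It is the only one because a split extension is determined by its action: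
a morphism on the bases compatible with the actions extends to the split extensions
(`SplitExtension.exists_hom_of_action`). Naturality of the kernel pair in the extension then shows
that every morphism of extensions is compatible with `ρ`.
-/

namespace SemiAb

variable {C : Type u} [Category.{v} C] [HasZeroMorphisms C]

theorem IsCokernelOf.isRegularEpi {A B Q : C} {q : B ⟶ Q} {f : A ⟶ B} (h : IsCokernelOf q f) :
    IsRegularEpi q := by
  obtain ⟨w, ⟨hq⟩⟩ := h
  have : NormalEpi q := ⟨A, f, w, hq⟩
  exact ⟨⟨this.regularEpi⟩⟩

/-- The image of a pair of morphisms, as a relation. -/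
theorem exists_isRegularEpi_jointly_mono {D : Type u} [Category.{v} D] [Regular D] {S A B : D}
    (a : S ⟶ A) (b : S ⟶ B) : ∃ (M : D) (q : S ⟶ M) (u : M ⟶ A) (v : M ⟶ B), IsRegularEpi q ∧
      q ≫ u = a ∧ q ≫ v = b ∧
      ∀ {T : D} (x y : T ⟶ M), x ≫ u = y ≫ u → x ≫ v = y ≫ v → x = y := by
  let F := Regular.strongEpiMonoFactorisation (prod.lift a b)
  refine ⟨F.I, F.e, F.m ≫ prod.fst, F.m ≫ prod.snd,
    inferInstanceAs (IsRegularEpi (Regular.strongEpiMonoFactorisation _).e), ?_, ?_, ?_⟩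
  · rw [← Category.assoc, F.fac, prod.lift_fst]
  · rw [← Category.assoc, F.fac, prod.lift_snd]
  · intro T x y hx hy
    rw [← cancel_mono F.m]
    apply Limits.prod.hom_ext
    · rwa [Category.assoc, Category.assoc]
    · rwa [Category.assoc, Category.assoc]

variable [HasZeroObject C] [SemiAbelian C] {G : C}

/-! ### Split extensions are determined by their actions -/

namespace SplitExtension

/-- The main step in reconstructing a split extension `X` from its action. If `B + G` maps by a
regular epimorphism `q` onto a relation `(u, v)` from `X.A` to `Y.A`, then `G` is a kernel of the
resulting split epimorphism: modulo a regular epimorphism, an element of the kernel lifts to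
`B ♭ G`, and there `q` takes the value of the common action. -/
theorem isKernelOf_of_isRegularEpi {X Y : SplitExtension G} {b : X.B ⟶ Y.B}
    (h : flatMap b (𝟙 G) ≫ Y.action = X.action) {M : C} {q : X.B ⨿ G ⟶ M} [IsRegularEpi q]
    {u : M ⟶ X.A} {v : M ⟶ Y.A} (hu : q ≫ u = coprod.desc X.s X.k)
    (hv : q ≫ v = coprod.desc (b ≫ Y.s) Y.k)
    (huv : ∀ {T : C} (x y : T ⟶ M), x ≫ u = y ≫ u → x ≫ v = y ≫ v → x = y) :
    IsKernelOf (coprod.inr ≫ q) (u ≫ X.p) := by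
  have hku : (coprod.inr ≫ q) ≫ u = X.k := by rw [Category.assoc, hu, coprod.inr_desc]
  have hkv : (coprod.inr ≫ q) ≫ v = Y.k := by rw [Category.assoc, hv, coprod.inr_desc]
  have hq : flatι X.B G ≫ q = X.action ≫ coprod.inr ≫ q := by
    apply huv
    · rw [Category.assoc, hu, Category.assoc, hku, action_k]
    · have e : coprod.desc (b ≫ Y.s) Y.k = coprod.map b (𝟙 G) ≫ coprod.desc Y.s Y.k := by
        rw [coprod.map_desc, Category.id_comp]
      rw [Category.assoc, hv, Category.assoc, hkv, ← h, Category.assoc, action_k, e,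
        ← Category.assoc, ← flatMap_ι, Category.assoc]
  refine IsKernelOf.mk' ?_ (fun x y e => X.isKernel.hom_ext ?_) fun {T} a ha => ?_
  · rw [← Category.assoc, hku, X.isKernel.comp_zero]
  · rw [← hku, ← Category.assoc, e, Category.assoc]
  · obtain ⟨t, ht⟩ := X.isKernel.exists_lift (a ≫ u) (by rw [Category.assoc, ha])
    have hp : pullback.snd a q ≫ coprod.desc (𝟙 X.B) (0 : G ⟶ X.B) = 0 := by
      have e : coprod.desc (𝟙 X.B) (0 : G ⟶ X.B) = q ≫ u ≫ X.p := by
        rw [← Category.assoc, hu, coprod.desc_comp, X.s_p, X.isKernel.comp_zero]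
      rw [e, ← Category.assoc, ← pullback.condition, Category.assoc, ha, comp_zero]
    have ha' : pullback.fst a q ≫ a =
        (flatLift (pullback.snd a q) hp ≫ X.action) ≫ coprod.inr ≫ q := by
      rw [Category.assoc, ← hq, ← Category.assoc, flatLift_ι, pullback.condition]
    have ht' : pullback.fst a q ≫ t = flatLift (pullback.snd a q) hp ≫ X.action := by
      apply X.isKernel.hom_ext
      rw [Category.assoc, ht, ← Category.assoc, ha', Category.assoc, hku]
    refine ⟨t, ?_⟩
    rw [← cancel_epi (pullback.fst a q), ha', ← ht', Category.assoc]

/-- Morphisms of split extensions inducing the identity on the kernel object are the morphisms of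
the bases that are compatible with the actions. The graph of the morphism `X.A ⟶ Y.A` is the image
of `B + G` in `X.A × Y.A`, which projects isomorphically onto `X.A` by the split short five lemma. -/
theorem exists_hom_of_action {X Y : SplitExtension G} (b : X.B ⟶ Y.B)
    (h : flatMap b (𝟙 G) ≫ Y.action = X.action) : ∃ a : X ⟶ Y, a.base = b := by
  obtain ⟨M, q, u, v, _, hu, hv, huv⟩ := exists_isRegularEpi_jointly_mono
    (coprod.desc X.s X.k) (coprod.desc (b ≫ Y.s) Y.k)
  have hsu : (coprod.inl ≫ q) ≫ u = X.s := by rw [Category.assoc, hu, coprod.inl_desc]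
  have hku : (coprod.inr ≫ q) ≫ u = X.k := by rw [Category.assoc, hu, coprod.inr_desc]
  have hsv : (coprod.inl ≫ q) ≫ v = b ≫ Y.s := by rw [Category.assoc, hv, coprod.inl_desc]
  have hkv : (coprod.inr ≫ q) ≫ v = Y.k := by rw [Category.assoc, hv, coprod.inr_desc]
  have : IsIso u := SemiAbelian.split_short_five (coprod.inr ≫ q) (u ≫ X.p) (coprod.inl ≫ q)
    X.k X.p X.s (isKernelOf_of_isRegularEpi h hu hv huv) (by rw [← Category.assoc, hsu, X.s_p])
    X.isKernel X.s_p (𝟙 G) u (𝟙 X.B) (by rw [hku, Category.id_comp]) (Category.comp_id _)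
    (by rw [hsu, Category.id_comp]) inferInstance inferInstance
  have huv' : u ≫ X.p ≫ b = v ≫ Y.p := by
    rw [← cancel_epi q, ← Category.assoc, hu, ← Category.assoc q, hv, coprod.desc_comp,
      coprod.desc_comp, Y.isKernel.comp_zero, Category.assoc, Y.s_p, ← Category.assoc X.s, X.s_p,
      ← Category.assoc X.k, X.isKernel.comp_zero, Category.id_comp, Category.comp_id, zero_comp]
  refine ⟨⟨b, inv u ≫ v, ?_, ?_, ?_⟩, rfl⟩
  · rw [← hkv, ← hku, Category.assoc _ u, IsIso.hom_inv_id_assoc]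
  · rw [Category.assoc, ← huv', IsIso.inv_hom_id_assoc]
  · rw [← hsv, ← hsu, Category.assoc _ u, IsIso.hom_inv_id_assoc]

end SplitExtension

theorem SplitExtensionClassifier.eq_classify_of_action (A : SplitExtensionClassifier G)
    {X : SplitExtension G} (b : X.B ⟶ A.aut) (h : flatMap b (𝟙 G) ≫ A.ev = X.action) :
    b = A.classify X := by
  obtain ⟨a, rfl⟩ := SplitExtension.exists_hom_of_action b h
  exact A.base_eq a

/-! ### Extensions and their kernel pairs -/

namespace Extension

variable {H : C}

/-- The split extension `G ⟶ Y.E ×_H X.E ⇄ X.E` given by `⟨ι, 0⟩`, the second projection and the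
section `⟨f, 1⟩`. It is the pullback of the extension `Y` along `X.σ`, split by `f`. -/
noncomputable def pullbackSplit {X Y : Extension H G} (f : X ⟶ Y) : SplitExtension G where
  B := X.E
  A := pullback Y.σ X.σ
  k := pullback.lift Y.ι 0 (by rw [Y.isKernel.comp_zero, zero_comp])
  p := pullback.snd Y.σ X.σ
  s := pullback.lift f.f (𝟙 X.E) (by rw [f.f_σ, Category.id_comp])
  isKernel := IsKernelOf.mk' (pullback.lift_snd _ _ _)
    (fun a b h => Y.isKernel.hom_ext (by
      simpa [pullback.lift_fst] using congrArg (· ≫ pullback.fst Y.σ X.σ) h))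
    (fun a h => by
      obtain ⟨l, hl⟩ := Y.isKernel.exists_lift (a ≫ pullback.fst Y.σ X.σ) (by
        rw [Category.assoc, pullback.condition, ← Category.assoc, h, zero_comp])
      refine ⟨l, pullback.hom_ext ?_ ?_⟩
      · rw [Category.assoc, pullback.lift_fst, hl]
      · rw [Category.assoc, pullback.lift_snd, h, comp_zero])
  s_p := pullback.lift_snd _ _ _

/-- The split extension `G ⟶ E ×_H E ⇄ E` of the kernel pair of `σ`. -/
noncomputable def kernelPair (X : Extension H G) : SplitExtension G := pullbackSplit (𝟙 X)

/-- The action of `E` on `G` given by the kernel pair of an extension is conjugation in `E`. -/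
theorem kernelPair_action_ι (X : Extension H G) :
    X.kernelPair.action ≫ X.ι = flatMap (𝟙 X.E) X.ι ≫ conj X.E := by
  have key : ∀ {P : C} (k : G ⟶ P) (s : X.E ⟶ P) (p : P ⟶ X.E) (α : flat X.E G ⟶ G),
      k ≫ p = X.ι → s ≫ p = 𝟙 X.E → α ≫ k = flatι X.E G ≫ coprod.desc s k →
      α ≫ X.ι = flatMap (𝟙 X.E) X.ι ≫ conj X.E := by
    intro P k s p α hk hs hα
    rw [conj, ← Category.assoc (flatMap _ _), flatMap_ι, Category.assoc, coprod.map_desc,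
      Category.comp_id, Category.comp_id, ← hs, ← hk, ← coprod.desc_comp, ← Category.assoc, hα,
      Category.assoc]
  exact key X.kernelPair.k X.kernelPair.s (pullback.fst X.σ X.σ) X.kernelPair.action
    (pullback.lift_fst _ _ _) (pullback.lift_fst _ _ _) X.kernelPair.action_k

/-- The morphism from the diagonal split extension of `G` to the kernel pair, induced by `ι`. -/
noncomputable def diagonalToKernelPair (X : Extension H G) :
    SplitExtension.diagonal G ⟶ X.kernelPair where
  base := X.ι
  total := (pullback.lift (prod.fst ≫ X.ι) (prod.snd ≫ X.ι)
    (by simp [X.isKernel.comp_zero]) : G ⨯ G ⟶ pullback X.σ X.σ)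
  k_total := by
    change prod.lift (𝟙 G) 0 ≫ _ = pullback.lift X.ι 0 _
    apply pullback.hom_ext <;> simp [pullback.lift_fst, pullback.lift_snd,
      prod.lift_fst_assoc, prod.lift_snd_assoc]
  p_base := by
    change prod.snd ≫ X.ι = _ ≫ pullback.snd X.σ X.σ
    rw [pullback.lift_snd]
  s_total := by
    change prod.lift (𝟙 G) (𝟙 G) ≫ _ = X.ι ≫ pullback.lift (𝟙 _) (𝟙 _) _
    apply pullback.hom_ext <;> simp [pullback.lift_fst, pullback.lift_snd,
      prod.lift_fst_assoc, prod.lift_snd_assoc]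

/-- The kernel pair is functorial in the extension. -/
noncomputable def kernelPairMap {X Y : Extension H G} (f : X ⟶ Y) :
    X.kernelPair ⟶ Y.kernelPair where
  base := f.f
  total := (pullback.lift (pullback.fst X.σ X.σ ≫ f.f) (pullback.snd X.σ X.σ ≫ f.f)
    (by simp [f.f_σ, pullback.condition]) : pullback X.σ X.σ ⟶ pullback Y.σ Y.σ)
  k_total := by
    change pullback.lift X.ι 0 _ ≫ _ = pullback.lift Y.ι 0 _
    apply pullback.hom_ext <;> simp [pullback.lift_fst, pullback.lift_snd,
      pullback.lift_fst_assoc, pullback.lift_snd_assoc, f.ι_f]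
  p_base := by
    change pullback.snd X.σ X.σ ≫ f.f = _ ≫ pullback.snd Y.σ Y.σ
    rw [pullback.lift_snd]
  s_total := by
    change pullback.lift (𝟙 _) (𝟙 _) _ ≫ _ = f.f ≫ pullback.lift (𝟙 _) (𝟙 _) _
    apply pullback.hom_ext <;> simp [pullback.lift_fst, pullback.lift_snd,
      pullback.lift_fst_assoc, pullback.lift_snd_assoc]

/-- The comparison `E ×_H E ⟶ E' ×_H E` is invertible, as a morphism of split extensions over
`E` with the same kernel object. -/
theorem isIso_pullback_lift {X Y : Extension H G} (f : X ⟶ Y) :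
    IsIso (pullback.lift (pullback.fst X.σ X.σ ≫ f.f) (pullback.snd X.σ X.σ)
      (by rw [Category.assoc, f.f_σ, pullback.condition]) :
        pullback X.σ X.σ ⟶ pullback Y.σ X.σ) := by
  refine SemiAbelian.split_short_five X.kernelPair.k X.kernelPair.p X.kernelPair.s
    (pullbackSplit f).k (pullbackSplit f).p (pullbackSplit f).s X.kernelPair.isKernel
    X.kernelPair.s_p (pullbackSplit f).isKernel (pullbackSplit f).s_p (𝟙 G) _ (𝟙 X.E) ?_ ?_ ?_
    inferInstance (IsIso.id X.E)
  · change pullback.lift X.ι 0 _ ≫ _ = 𝟙 G ≫ pullback.lift Y.ι 0 _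
    apply pullback.hom_ext <;> simp [pullback.lift_fst, pullback.lift_snd,
      pullback.lift_fst_assoc, f.ι_f]
  · change pullback.snd X.σ X.σ ≫ 𝟙 X.E = _ ≫ pullback.snd Y.σ X.σ
    rw [pullback.lift_snd, Category.comp_id]
  · change pullback.lift (𝟙 _) (𝟙 _) _ ≫ _ = 𝟙 X.E ≫ pullback.lift f.f (𝟙 _) _
    apply pullback.hom_ext <;> simp [pullback.lift_fst, pullback.lift_snd,
      pullback.lift_fst_assoc]

/-- The short five lemma. -/
theorem isIso_f {X Y : Extension H G} (f : X ⟶ Y) : IsIso f.f := by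
  have := X.isCokernel.isRegularEpi
  have hφ := isIso_pullback_lift f
  set φ : pullback X.σ X.σ ⟶ pullback Y.σ X.σ := pullback.lift (pullback.fst X.σ X.σ ≫ f.f)
    (pullback.snd X.σ X.σ) (by rw [Category.assoc, f.f_σ, pullback.condition])
  have hφ₁ : φ ≫ pullback.fst Y.σ X.σ = pullback.fst X.σ X.σ ≫ f.f := pullback.lift_fst _ _ _
  have hφ₂ : φ ≫ pullback.snd Y.σ X.σ = pullback.snd X.σ X.σ := pullback.lift_snd _ _ _
  -- `E' ×_H E ⟶ E'` is a regular epimorphism, being a pullback of `σ`, and it factors through `f`.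
  have : StrongEpi (pullback.fst X.σ X.σ ≫ f.f) := by
    rw [← hφ₁]
    exact strongEpi_comp _ _
  have : StrongEpi f.f := strongEpi_of_strongEpi (pullback.fst X.σ X.σ) f.f
  -- If `f` identifies `a` and `b`, then the comparison identifies `(a, a)` and `(b, a)`.
  have : Mono f.f := ⟨fun {T} a b h => by
    have hσ : b ≫ X.σ = a ≫ X.σ := by
      rw [← f.f_σ, ← Category.assoc, ← h, Category.assoc]
    have e : pullback.lift a a rfl = pullback.lift b a hσ := by
      rw [← cancel_mono φ]
      apply pullback.hom_ext
      · simp only [Category.assoc, hφ₁, pullback.lift_fst_assoc, h]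
      · simp only [Category.assoc, hφ₂, pullback.lift_snd]
    simpa only [pullback.lift_fst] using congrArg (· ≫ pullback.fst X.σ X.σ) e⟩
  exact isIso_of_mono_of_strongEpi f.f

instance isGroupoid : IsGroupoid (Extension H G) where
  all_isIso {X Y} f := by
    have := isIso_f f
    exact ⟨⟨inv f.f, by rw [IsIso.comp_inv_eq, f.ι_f], by rw [IsIso.inv_comp_eq, f.f_σ]⟩,
      Hom.ext (IsIso.hom_inv_id f.f), Hom.ext (IsIso.inv_hom_id f.f)⟩

end Extension

/-! ### Butterflies out of a discrete crossed module -/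

namespace Butterfly

/-- The extension underlying a butterfly. -/
def toExtension {M N : CrossedModule C} (X : Butterfly M N) : Extension M.base N.top :=
  ⟨X.E, X.ι, X.σ, X.isKernel, X.isCokernel⟩

instance isGroupoid (M N : CrossedModule C) : IsGroupoid (Butterfly M N) where
  all_isIso {X Y} f := by
    have : IsIso f.f :=
      Extension.isIso_f (X := X.toExtension) (Y := Y.toExtension) ⟨f.f, f.ι_f, f.f_σ⟩
    exact ⟨⟨inv f.f, by rw [IsIso.comp_inv_eq, f.κ_f], by rw [IsIso.inv_comp_eq, f.f_ρ],
      by rw [IsIso.comp_inv_eq, f.ι_f], by rw [IsIso.inv_comp_eq, f.f_σ]⟩,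
      Hom.ext (IsIso.hom_inv_id f.f), Hom.ext (IsIso.inv_hom_id f.f)⟩

/-- The right wing of a butterfly into `A(G)` classifies the kernel pair of the extension. -/
theorem ρ_eq_classify {M : CrossedModule C} {A : SplitExtensionClassifier G}
    (X : Butterfly M A.crossedModule) :
    X.ρ = A.classify (Extension.kernelPair (G := G) X.toExtension) := by
  refine A.eq_classify_of_action (X := Extension.kernelPair (G := G) X.toExtension) X.ρ ?_
  apply X.isKernel.hom_ext
  exact (Category.assoc _ _ _).trans
    (X.right_act.trans (Extension.kernelPair_action_ι (G := G) X.toExtension).symm)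

end Butterfly

namespace Extension

variable {H : C}

/-- The butterfly `D(H) ⟶ A(G)` of an extension, whose `ρ` classifies the kernel pair. -/
noncomputable def toButterfly (A : SplitExtensionClassifier G) (X : Extension H G) :
    Butterfly (discrete H) A.crossedModule where
  E := X.E
  κ := 0
  ρ := A.classify X.kernelPair
  ι := X.ι
  σ := X.σ
  left_wing := zero_comp
  right_wing := A.base_eq (X.diagonalToKernelPair ≫ A.isTerminal.from X.kernelPair)
  complex := zero_comp
  isKernel := X.isKernel
  isCokernel := X.isCokernel
  left_act := by
    have h : coprod.map (𝟙 X.E) (0 : (discrete H).top ⟶ X.E) ≫ coprod.desc (𝟙 X.E) (𝟙 X.E) =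
        coprod.desc (𝟙 X.E) 0 := by
      rw [coprod.map_desc, Category.comp_id, Category.comp_id]
    rw [comp_zero, comp_zero, conj, ← Category.assoc, flatMap_ι, Category.assoc, h, flatι_desc]
  right_act := by
    have h : flatMap (A.classify X.kernelPair) (𝟙 G) ≫ A.ev = X.kernelPair.action :=
      SplitExtension.flatMap_action (A.isTerminal.from X.kernelPair)
    exact (Category.assoc _ _ _).symm.trans
      ((congrArg (· ≫ X.ι) h).trans X.kernelPair_action_ι)

end Extension

theorem toButterfly_butterflyToExtension_obj {H : C} (A : SplitExtensionClassifier G)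
    (X : Butterfly (discrete H) A.crossedModule) :
    ((butterflyToExtension H A).obj X).toButterfly A = X := by
  have hρ : A.classify (Extension.kernelPair (G := G) X.toExtension) = X.ρ := X.ρ_eq_classify.symm
  have hκ : 0 = X.κ := (isZero_zero C).eq_of_src _ _
  obtain ⟨E, κ, ρ, ι, σ⟩ := X
  simp only [Extension.toButterfly, butterflyToExtension]
  congr 1

instance butterflyToExtension_isIso (H : C) (A : SplitExtensionClassifier G) :
    (butterflyToExtension H A).IsIso where
  faithful := ⟨fun h => Butterfly.Hom.ext (congrArg Extension.Hom.f h)⟩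
  full := ⟨fun {X Y} f => ⟨⟨f.f, (isZero_zero C).eq_of_src _ _, by
    rw [X.ρ_eq_classify, Y.ρ_eq_classify]
    exact A.base_eq (Extension.kernelPairMap f ≫ A.isTerminal.from _), f.ι_f, f.f_σ⟩, rfl⟩⟩
  bijective_obj := Function.bijective_iff_has_inverse.mpr
    ⟨Extension.toButterfly A, toButterfly_butterflyToExtension_obj A, fun _ => rfl⟩

instance splitButterflyToSplitExtension_isIso (H : C) (A : SplitExtensionClassifier G) :
    (splitButterflyToSplitExtension H A).IsIso where
  faithful := ⟨fun h => by
    apply ObjectProperty.hom_ext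
    exact (butterflyToExtension H A).map_injective (congrArg (·.hom) h)⟩
  full := ⟨fun f => ⟨ObjectProperty.homMk ((butterflyToExtension H A).preimage f.hom),
    ObjectProperty.hom_ext _ ((butterflyToExtension H A).map_preimage f.hom)⟩⟩
  bijective_obj := Function.bijective_iff_has_inverse.mpr
    ⟨fun X => ⟨X.obj.toButterfly A, X.property⟩,
      fun X => ObjectProperty.FullSubcategory.ext (toButterfly_butterflyToExtension_obj A X.obj),
      fun _ => rfl⟩

end SemiAb

theorem mainTheorem4 {C : Type u} [Category.{v} C] [HasZeroObject C] [HasZeroMorphisms C]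
    [SemiAb.SemiAbelian C] (H G : C) (A : SemiAb.SplitExtensionClassifier G) :
    IsGroupoid (SemiAb.Extension H G) ∧
    IsGroupoid (SemiAb.Butterfly (SemiAb.discrete H) A.crossedModule) ∧
    (SemiAb.butterflyToExtension H A).IsIso ∧
    (SemiAb.splitButterflyToSplitExtension H A).IsIso :=
  ⟨inferInstance, inferInstance, inferInstance, inferInstance⟩
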